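/- Let $c_0=\frac{1}{2e(e-1)^2}$ and $c_1=\frac{1}{36(e-1)\sqrt{2e}}$; these are positive absolute constants. Let $d\ge 1$ be an integer, $p\in[2,\infty]$, $\varepsilon\in(0,1]$, $D>0$, $B>0$, and let $T\in\mathbb N$ satisfy $T\ge c_0\,d^2/\varepsilon^2$. Then $$\sup_{\mathcal X\in\mathbb X_p(D)}\mathcal E^*(\mathcal X,\mathcal O_{\mathrm c,p},T,\mathcal W_{\mathrm{priv},\varepsilon})\;\ge\;\frac{c_1\,D\,B\,d^{1/2-1/p}}{\sqrt T}\cdot\sqrt{\frac{d}{\varepsilon^2}}\qquad(1/\infty=0).$$ Here $\mathbb X_p(D)$ is the collection of nonempty compact convex sets $\mathcal X\subseteq\mathbb R^d$ with $\max_{x,y\in\mathcal X}\|x-y\|_p\le D$. The class $\mathcal O_{\mathrm c,p}$ consists of all pairs $(f,O)$ where $f:\mathcal X\to\mathbb R$ is convex and $O$ is a stochastic first-order oracle which answers a query $x\in\mathcal X$ by a random vector $\hat g(x)\in\mathbb R^d$ (with a law depending only on $x$) such that $\mathbb E[\hat g(x)]$ is a subgradient of $f$ at $x$ on $\mathcal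 X$ and $\|\hat g(x)\|_q^2\le B^2$ almost surely, where $1/p+1/q=1$. The family $\mathcal W_{\mathrm{priv},\varepsilon}$ consists of all $\varepsilon$-locally differentially private channels, that is, Markov kernels $W$ from $\mathbb R^d$ to $\mathbb R^d$ with $W(S\mid x)\le e^{\varepsilon}W(S\mid x')$ for all $x,x'\in\mathbb R^d$ and all Borel sets $S$. A (possibly randomized) first-order algorithm $\pi$ with $T$ queries works as follows: at each step it queries the oracle at a point of $\mathcal X$ that is a function of its random seed and of the messages received so far; the answer of the oracle is passed through a channel in $\mathcal W_{\mathrm{priv},\varepsilon}$, and only the output of the channel is given to the algorithm as its next message. The channel is chosen by an adaptive strategy $S$, as a function of the previous messages. After $T$ queries the algorithm outputs a point $x_T\in\mathcal X$, a function of its seed and of all $T$ messages. The adaptive minmax error is $$\mathcal E^*(\mathcal X,\mathcal O,T,\mathcal W)=\inf_{\pi}\inf_{S}\sup_{(f,O)\in\mathcal O}\mathbb E\Big[f(x_T)-\min_{x\in\mathcal X}f(x)\Big].$$ -/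

import Mathlib

open MeasureTheory ProbabilityTheory
open scoped ENNReal

noncomputable section

namespace LDPOpt

/-- The ambient space `ℝ^d`, with its Borel sigma-algebra. The `ℓ_p` norms are explicit below. -/
abbrev Vec (d : ℕ) : Type := Fin d → ℝ

/-- The `ℓ_p` norm on `ℝ^d`, for `p ∈ [1, ∞]`. -/
def pNorm {d : ℕ} (p : ℝ≥0∞) (x : Vec d) : ℝ := ‖WithLp.toLp p x‖

/-- The subgradients at `x` of a function `f` on the domain `X`:
the `g` with `f x - f y ≤ gᵀ (x - y)` for all `y ∈ X`. -/
def subgradients {d : ℕ} (X : Set (Vec d)) (f : Vec d → ℝ) (x : Vec d) : Set (Vec d) :=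
  {g | ∀ y ∈ X, f x - f y ≤ g ⬝ᵥ (x - y)}

/-- The domains: nonempty compact convex subsets of `ℝ^d` whose `ℓ_p` diameter is at most `D`. -/
def domains (d : ℕ) (p : ℝ≥0∞) (D : ℝ) : Set (Set (Vec d)) :=
  {X | X.Nonempty ∧ IsCompact X ∧ Convex ℝ X ∧ ∀ x ∈ X, ∀ y ∈ X, pNorm p (x - y) ≤ D}

/-- A channel with input and output in `ℝ^d` (a Markov kernel is required separately). -/
abbrev Channel (d : ℕ) : Type := Kernel (Vec d) (Vec d)

/-- A stochastic first-order oracle on the domain `X`: the law of the answer `ĝ(x)` to each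
query `x ∈ X`. -/
abbrev Oracle {d : ℕ} (X : Set (Vec d)) : Type := Kernel X (Vec d)

/-- The pairs (function, oracle) such that `f` is convex on `X`, and for each query `x ∈ X` the
answer `ĝ(x)` has mean in the set of subgradients of `f` at `x`, and `‖ĝ(x)‖_q ^ 2 ≤ B ^ 2`
almost surely, with `q` the Hölder conjugate of `p`. (The bound makes `ĝ(x)` integrable.) -/
def convexClass {d : ℕ} (X : Set (Vec d)) (p : ℝ≥0∞) (B : ℝ) : Set ((Vec d → ℝ) × Oracle X) :=
  {fO | ConvexOn ℝ X fO.1 ∧ IsMarkovKernel fO.2 ∧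
    (∀ x : X, (∫ g, g ∂(fO.2 x)) ∈ subgradients X fO.1 x) ∧
    (∀ x : X, ∀ᵐ g ∂(fO.2 x), pNorm (ENNReal.conjExponent p) g ^ 2 ≤ B ^ 2)}

/-- The `ε`-locally differentially private channels: `W (S | x) ≤ e^ε W (S | x')` for all inputs
`x, x'` and all Borel sets `S`. -/
def ldpChannels (d : ℕ) (ε : ℝ) : Set (Channel d) :=
  {W | IsMarkovKernel W ∧ ∀ x x' : Vec d, ∀ S : Set (Vec d), MeasurableSet S →
    W x S ≤ ENNReal.ofReal (Real.exp ε) * W x' S}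

/-- A first-order optimization algorithm on `X`, which may be randomized through a seed with an
arbitrary law. The point `x_t` (queried if `t < T`, the final output if `t = T`) is a measurable
function of the seed and of the `t` messages received so far. -/
structure Algorithm {d : ℕ} (X : Set (Vec d)) where
  Seed : Type
  [seedSpace : MeasurableSpace Seed]
  seedLaw : Measure Seed
  [seedProb : IsProbabilityMeasure seedLaw]
  point : (t : ℕ) → Seed × (Fin t → Vec d) → X
  measurable_point : ∀ t, Measurable (point t)

attribute [instance] Algorithm.seedSpace Algorithm.seedProb

/-- An adaptive channel selection strategy for the channel family `𝒲`: the channel used at time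
`t` is chosen in `𝒲` as a function of the `t` previous messages (jointly measurably in these
messages and the input of the channel). -/
structure Strategy {d : ℕ} (𝒲 : Set (Channel d)) where
  kernel : (t : ℕ) → Kernel ((Fin t → Vec d) × Vec d) (Vec d)
  mem : ∀ (t : ℕ) (h : Fin t → Vec d), (kernel t).comap (Prod.mk h) measurable_prodMk_left ∈ 𝒲

variable {d : ℕ} {X : Set (Vec d)} {𝒲 : Set (Channel d)}

/-- The conditional law of the gradient estimate `ĝ(x_t)` given the seed and the past messages. -/
def gradientKernel (O : Oracle X) (π : Algorithm X) (t : ℕ) :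
    Kernel (π.Seed × (Fin t → Vec d)) (Vec d) :=
  O.comap (π.point t) (π.measurable_point t)

/-- The conditional law of the new message given the seed and the past messages: the gradient
estimate at `x_t` is drawn and passed through the channel selected by `S`. -/
def messageKernel (O : Oracle X) (π : Algorithm X) (S : Strategy 𝒲) (t : ℕ) :
    Kernel (π.Seed × (Fin t → Vec d)) (Vec d) :=
  ((S.kernel t).comap
      (fun z : (π.Seed × (Fin t → Vec d)) × Vec d => (z.1.2, z.2)) (by fun_prop)) ∘ₖ
    (Kernel.id ×ₖ gradientKernel O π t)

/-- The joint law of the seed and of the first `t` messages. -/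
def transcript (O : Oracle X) (π : Algorithm X) (S : Strategy 𝒲) :
    (t : ℕ) → Measure (π.Seed × (Fin t → Vec d))
  | 0 => π.seedLaw.map (fun u => (u, Fin.elim0))
  | t + 1 => (transcript O π S t ⊗ₘ messageKernel O π S t).map
      (fun z => (z.1.1, (Fin.snoc z.1.2 z.2 : Fin (t + 1) → Vec d)))

/-- The expected optimality gap `E [f (x_T) - min_X f]` after `T` queries. The gap is nonnegative,
and the expectation is taken in `[0, ∞]`. -/
def expectedGap (T : ℕ) (f : Vec d → ℝ) (O : Oracle X) (π : Algorithm X) (S : Strategy 𝒲) : ℝ≥0∞ :=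
  ∫⁻ z, ENNReal.ofReal (f (π.point T z) - sInf (f '' X)) ∂(transcript O π S T)

/-- The adaptive minmax optimization error for the class `𝒪` of (function, oracle) pairs, `T`
queries, and the channel family `𝒲`. -/
def minmaxError (X : Set (Vec d)) (𝒪 : Set ((Vec d → ℝ) × Oracle X)) (T : ℕ)
    (𝒲 : Set (Channel d)) : ℝ≥0∞ :=
  ⨅ π : Algorithm X, ⨅ S : Strategy 𝒲, ⨆ fO ∈ 𝒪, expectedGap T fO.1 fO.2 π S

end LDPOpt

end

/-! The hard functions are linear, with gradient `(B γ / d) v` for a sign vector `v`, on a cube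
inscribed in the `ℓ_p` constraint. The oracle ignores the query and returns a random `± B e_i` with
bias `γ` towards `v`. Optimizing then means recovering most signs of `v`, and flipping one sign
moves a mass of only `γ / d` between two atoms.

A private channel contracts this change. One message satisfies `(E_μ φ)² ≤ (1 + η² (e^ε - 1)²) E_ν
φ²` with `η = γ / d` (`sq_integral_le_of_private`), a dual form of a chi-square bound. In this form
it multiplies along adaptive transcripts (`sq_integral_transcript_le`).

If `γ` keeps the `T`-fold factor at most `2`, no test separates two neighbouring sign vectors
(`integral_one_sub_add_integral_ge`). Assouad's averaging (`exists_sum_ge_of_flip`) gives a `v` with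
total coordinate loss at least `d / 4`, hence a gap of order `B γ b` on `[-b, b]^d`. -/

noncomputable section

namespace LDPOpt

/-! ### Contraction by a single private channel -/

section LocalPrivacy

variable {α Y : Type*} [MeasurableSpace α] [MeasurableSpace Y]

theorem integrable_of_measurable_of_abs_le {μ : Measure Y} [IsFiniteMeasure μ] {φ : Y → ℝ} {M : ℝ}
    (hφ : Measurable φ) (hM : ∀ y, |φ y| ≤ M) : Integrable φ μ :=
  Integrable.of_bound hφ.aestronglyMeasurable M (.of_forall hM)

theorem measurable_integral_kernel {κ : Kernel α Y} [IsMarkovKernel κ] {φ : Y → ℝ}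
    (hφ : Measurable φ) : Measurable fun x => ∫ y, φ y ∂κ x :=
  hφ.stronglyMeasurable.integral_kernel.measurable

theorem abs_integral_le_of_abs_le {μ : Measure Y} [IsProbabilityMeasure μ] {φ : Y → ℝ} {M : ℝ}
    (hM : ∀ y, |φ y| ≤ M) : |∫ y, φ y ∂μ| ≤ M := by
  simpa using norm_integral_le_of_norm_le_const (μ := μ) (f := φ) (.of_forall hM)

theorem integral_le_exp_mul_integral {μ ν : Measure Y} [IsProbabilityMeasure μ]
    [IsProbabilityMeasure ν] {ε : ℝ}
    (h : ∀ S, MeasurableSet S → μ S ≤ ENNReal.ofReal (Real.exp ε) * ν S)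
    {ψ : Y → ℝ} {M : ℝ} (hψ : Measurable ψ) (h0 : ∀ y, 0 ≤ ψ y) (hM : ∀ y, |ψ y| ≤ M) :
    ∫ y, ψ y ∂μ ≤ Real.exp ε * ∫ y, ψ y ∂ν := by
  have hle : μ ≤ ENNReal.ofReal (Real.exp ε) • ν :=
    Measure.le_intro fun S hS _ => by simpa using h S hS
  have hint : Integrable ψ (ENNReal.ofReal (Real.exp ε) • ν) :=
    (integrable_of_measurable_of_abs_le hψ hM).smul_measure ENNReal.ofReal_ne_top
  calc ∫ y, ψ y ∂μ ≤ ∫ y, ψ y ∂(ENNReal.ofReal (Real.exp ε) • ν) :=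
        integral_mono_measure hle (.of_forall h0) hint
    _ = Real.exp ε * ∫ y, ψ y ∂ν := by
        rw [integral_smul_measure, ENNReal.toReal_ofReal (Real.exp_pos ε).le, smul_eq_mul]

/-- Privacy gives `U a ≤ e^ε inf U`, while `inf U ≤ U b`. The infimum is also at most the mean of
`U` under any input law, so `μ` is free. -/
theorem integral_sub_integral_le_of_nonneg {κ : Kernel α Y} [IsMarkovKernel κ] {ε : ℝ}
    (hκ : ∀ x x' S, MeasurableSet S → κ x S ≤ ENNReal.ofReal (Real.exp ε) * κ x' S)
    (μ : Measure α) [IsProbabilityMeasure μ]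
    {ψ : Y → ℝ} {M : ℝ} (hψ : Measurable ψ) (h0 : ∀ y, 0 ≤ ψ y) (hM : ∀ y, |ψ y| ≤ M)
    (hε : 0 ≤ ε) (a b : α) :
    ∫ y, ψ y ∂κ a - ∫ y, ψ y ∂κ b ≤ (Real.exp ε - 1) * ∫ x, ∫ y, ψ y ∂κ x ∂μ := by
  set U : α → ℝ := fun x => ∫ y, ψ y ∂κ x
  have hU0 : ∀ x, 0 ≤ U x := fun x => integral_nonneg h0
  have hbdd : BddBelow (Set.range U) := ⟨0, by rintro _ ⟨x, rfl⟩; exact hU0 x⟩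
  have : Nonempty α := ⟨a⟩
  have hb : iInf U ≤ U b := ciInf_le hbdd b
  have ha : U a ≤ Real.exp ε * iInf U := by
    rw [← div_le_iff₀' (Real.exp_pos ε)]
    refine le_ciInf fun x => ?_
    rw [div_le_iff₀' (Real.exp_pos ε)]
    exact integral_le_exp_mul_integral (hκ a x) hψ h0 hM
  have hm : iInf U ≤ ∫ x, U x ∂μ := by
    have := integral_mono (μ := μ) (integrable_const (iInf U))
      (integrable_of_measurable_of_abs_le (measurable_integral_kernel hψ)
        fun x => abs_integral_le_of_abs_le hM) (fun x => ciInf_le hbdd x)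
    simpa using this
  have h1 : 0 ≤ Real.exp ε - 1 := by linarith [Real.one_le_exp hε]
  change U a - U b ≤ (Real.exp ε - 1) * ∫ x, U x ∂μ
  nlinarith [mul_le_mul_of_nonneg_left hm h1]

/-- The nonnegative case applies to the positive and negative parts of `ψ`, and the two bounds add
up to the integral of `|ψ|`. -/
theorem abs_integral_sub_integral_le {κ : Kernel α Y} [IsMarkovKernel κ] {ε : ℝ}
    (hκ : ∀ x x' S, MeasurableSet S → κ x S ≤ ENNReal.ofReal (Real.exp ε) * κ x' S)
    (μ : Measure α) [IsProbabilityMeasure μ]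
    {ψ : Y → ℝ} {M : ℝ} (hψ : Measurable ψ) (hM : ∀ y, |ψ y| ≤ M) (hε : 0 ≤ ε) (a b : α) :
    |∫ y, ψ y ∂κ a - ∫ y, ψ y ∂κ b| ≤ (Real.exp ε - 1) * ∫ x, ∫ y, |ψ y| ∂κ x ∂μ := by
  have hp : Measurable fun y => max (ψ y) 0 := hψ.max measurable_const
  have hn : Measurable fun y => max (-ψ y) 0 := hψ.neg.max measurable_const
  have hpM : ∀ y, |max (ψ y) 0| ≤ M := fun y => by
    rw [abs_of_nonneg (le_max_right _ _)]
    exact (max_le (le_abs_self _) (abs_nonneg _)).trans (hM y)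
  have hnM : ∀ y, |max (-ψ y) 0| ≤ M := fun y => by
    rw [abs_of_nonneg (le_max_right _ _)]
    exact (max_le (neg_le_abs _) (abs_nonneg _)).trans (hM y)
  have hsub : ∀ x, ∫ y, ψ y ∂κ x = ∫ y, max (ψ y) 0 ∂κ x - ∫ y, max (-ψ y) 0 ∂κ x := fun x => by
    rw [← integral_sub (integrable_of_measurable_of_abs_le hp hpM)
      (integrable_of_measurable_of_abs_le hn hnM)]
    exact integral_congr_ae (.of_forall fun y => by
      rcases le_total (ψ y) 0 with h | h <;> simp [h])
  have hadd : ∀ x, ∫ y, |ψ y| ∂κ x = ∫ y, max (ψ y) 0 ∂κ x + ∫ y, max (-ψ y) 0 ∂κ x := fun x => by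
    rw [← integral_add (integrable_of_measurable_of_abs_le hp hpM)
      (integrable_of_measurable_of_abs_le hn hnM)]
    exact integral_congr_ae (.of_forall fun y => by
      rcases le_total (ψ y) 0 with h | h <;> simp [h, abs_of_nonneg, abs_of_nonpos])
  have hint : ∫ x, ∫ y, |ψ y| ∂κ x ∂μ =
      ∫ x, ∫ y, max (ψ y) 0 ∂κ x ∂μ + ∫ x, ∫ y, max (-ψ y) 0 ∂κ x ∂μ := by
    simp_rw [hadd]
    exact integral_add
      (integrable_of_measurable_of_abs_le (measurable_integral_kernel hp)
        fun x => abs_integral_le_of_abs_le hpM)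
      (integrable_of_measurable_of_abs_le (measurable_integral_kernel hn)
        fun x => abs_integral_le_of_abs_le hnM)
  have p1 := integral_sub_integral_le_of_nonneg hκ μ hp (fun y => le_max_right _ _) hpM hε a b
  have p2 := integral_sub_integral_le_of_nonneg hκ μ hp (fun y => le_max_right _ _) hpM hε b a
  have n1 := integral_sub_integral_le_of_nonneg hκ μ hn (fun y => le_max_right _ _) hnM hε a b
  have n2 := integral_sub_integral_le_of_nonneg hκ μ hn (fun y => le_max_right _ _) hnM hε b a
  rw [hsub a, hsub b, hint, abs_le]
  constructor <;> linarith

theorem sq_integral_abs_sub_integral_le {μ : Measure Y} [IsProbabilityMeasure μ] {φ : Y → ℝ}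
    {M : ℝ} (hφ : Measurable φ) (hM : ∀ y, |φ y| ≤ M) :
    (∫ y, |φ y - ∫ z, φ z ∂μ| ∂μ) ^ 2 ≤ ∫ y, φ y ^ 2 ∂μ - (∫ y, φ y ∂μ) ^ 2 := by
  have sq : ∀ f : Y → ℝ, MemLp f 2 μ → (∫ y, f y ∂μ) ^ 2 = ∫ y, f y ^ 2 ∂μ - variance f μ := by
    intro f hf
    have := variance_eq_sub hf
    simp only [Pi.pow_apply] at this
    linarith
  have hφ2 : MemLp φ 2 μ := MemLp.of_bound hφ.aestronglyMeasurable M (.of_forall hM)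
  have h2 : MemLp (fun y => |φ y - ∫ z, φ z ∂μ|) 2 μ := (hφ2.sub (memLp_const _)).abs
  rw [sq _ h2, sq _ hφ2, variance_eq_integral hφ.aemeasurable]
  simp only [sq_abs]
  linarith [variance_nonneg (fun y => |φ y - ∫ z, φ z ∂μ|) μ]

/-- The second moment comparison for the output of a private channel, when the input laws `μ`, `ν`
differ by moving a mass `η` from `b` to `a`. -/
theorem sq_integral_le_of_private {κ : Kernel α Y} [IsMarkovKernel κ] {ε : ℝ}
    (hκ : ∀ x x' S, MeasurableSet S → κ x S ≤ ENNReal.ofReal (Real.exp ε) * κ x' S)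
    (hε : 0 ≤ ε) {μ ν : Measure α} [IsProbabilityMeasure ν] {η : ℝ} {a b : α}
    (h : ∀ u : α → ℝ, ∫ x, u x ∂μ - ∫ x, u x ∂ν = η * (u a - u b))
    {φ : Y → ℝ} {M : ℝ} (hφ : Measurable φ) (hM : ∀ y, |φ y| ≤ M) :
    (∫ x, ∫ y, φ y ∂κ x ∂μ) ^ 2 ≤
      (1 + η ^ 2 * (Real.exp ε - 1) ^ 2) * ∫ x, ∫ y, φ y ^ 2 ∂κ x ∂ν := by
  have hcomp : ∀ (f : Y → ℝ) (N : ℝ), Measurable f → (∀ y, |f y| ≤ N) →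
      ∫ x, ∫ y, f y ∂κ x ∂ν = ∫ y, f y ∂(κ ∘ₘ ν) := fun f N hf hN => by
    rw [Measure.comp_eq_comp_const_apply,
      Kernel.integral_comp (integrable_of_measurable_of_abs_le hf hN), Kernel.const_apply]
  set A := ∫ y, φ y ∂(κ ∘ₘ ν) with hA
  set V := ∫ y, |φ y - A| ∂(κ ∘ₘ ν) with hV
  have hsub : Measurable fun y => φ y - A := hφ.sub_const A
  have hsubM : ∀ y, |φ y - A| ≤ M + |A| := fun y => (abs_sub _ _).trans (by linarith [hM y])
  -- Constants cancel in the difference, so `φ` can be centred first; the bound is then controlled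
  -- by a variance.
  have hdiff : |∫ y, φ y ∂κ a - ∫ y, φ y ∂κ b| ≤ (Real.exp ε - 1) * V := by
    have := abs_integral_sub_integral_le hκ ν hsub hsubM hε a b
    rw [hcomp _ (M + |A|) hsub.abs (by simpa using hsubM)] at this
    simpa [integral_sub (integrable_of_measurable_of_abs_le hφ hM) (integrable_const A)] using this
  have hvar : V ^ 2 ≤ ∫ y, φ y ^ 2 ∂(κ ∘ₘ ν) - A ^ 2 := sq_integral_abs_sub_integral_le hφ hM
  have hP := h fun x => ∫ y, φ y ∂κ x
  rw [hcomp φ M hφ hM] at hP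
  rw [hcomp _ (M ^ 2) (hφ.pow_const 2) (fun y => by
    rw [abs_pow]; exact pow_le_pow_left₀ (abs_nonneg _) (hM y) 2)]
  set S := ∫ y, φ y ^ 2 ∂(κ ∘ₘ ν)
  set δ := ∫ y, φ y ∂κ a - ∫ y, φ y ∂κ b
  have hP' : ∫ x, ∫ y, φ y ∂κ x ∂μ = A + η * δ := by linarith
  rw [hP']
  set K := Real.exp ε - 1
  have hδ : δ ^ 2 ≤ K ^ 2 * V ^ 2 := by
    rw [← mul_pow, ← sq_abs δ]; exact pow_le_pow_left₀ (abs_nonneg _) hdiff 2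
  have key : δ ^ 2 ≤ K ^ 2 * (S - A ^ 2) :=
    hδ.trans (mul_le_mul_of_nonneg_left hvar (sq_nonneg K))
  have hVA : 0 ≤ S - A ^ 2 := (sq_nonneg V).trans hvar
  -- With `δ = K w`, `key` says `w² ≤ S - A²`, and Cauchy–Schwarz gives `(A + η K w)² ≤ (1 + η²
  -- K²)(A² + w²)`. The case `K = 0` forces `δ = 0`.
  by_cases hK : K = 0
  · have : δ = 0 := by
      have : δ ^ 2 ≤ 0 := by simpa [hK] using key
      exact (pow_eq_zero_iff two_ne_zero).1 (le_antisymm this (sq_nonneg _))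
    rw [this, hK]; nlinarith
  · have hKK : 0 < K ^ 2 := by positivity
    obtain ⟨w, hw⟩ : ∃ w, δ = K * w := ⟨δ / K, by field_simp⟩
    rw [hw, mul_pow] at key
    have hw2 : w ^ 2 ≤ S - A ^ 2 := le_of_mul_le_mul_left key hKK
    have : (1 + η ^ 2 * K ^ 2) * (A ^ 2 + w ^ 2) ≤ (1 + η ^ 2 * K ^ 2) * S :=
      mul_le_mul_of_nonneg_left (by linarith) (by positivity)
    rw [hw]
    nlinarith [sq_nonneg (η * K * A - w)]

end LocalPrivacy

/-! ### Tensorization along adaptive transcripts -/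

section Transcript

variable {d : ℕ} {X : Set (Vec d)} {ε : ℝ}

theorem isMarkovKernel_strategy (S : Strategy (ldpChannels d ε)) (t : ℕ) :
    IsMarkovKernel (S.kernel t) :=
  ⟨fun z => (S.mem t z.1).1.isProbabilityMeasure z.2⟩

theorem isMarkovKernel_messageKernel (O : Oracle X) [IsMarkovKernel O] (π : Algorithm X)
    (S : Strategy (ldpChannels d ε)) (t : ℕ) : IsMarkovKernel (messageKernel O π S t) := by
  have := isMarkovKernel_strategy S t
  unfold messageKernel gradientKernel
  infer_instance

theorem measurable_snoc (σ : Type*) [MeasurableSpace σ] (t : ℕ) :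
    Measurable fun z : (σ × (Fin t → Vec d)) × Vec d =>
      (z.1.1, (Fin.snoc z.1.2 z.2 : Fin (t + 1) → Vec d)) := by
  refine measurable_fst.fst.prodMk (measurable_pi_lambda _ fun i => ?_)
  refine Fin.lastCases ?_ (fun j => ?_) i
  · simpa using measurable_snd
  · simp only [Fin.snoc_castSucc]
    exact (measurable_pi_apply j).comp measurable_fst.snd

theorem isProbabilityMeasure_transcript (O : Oracle X) [IsMarkovKernel O] (π : Algorithm X)
    (S : Strategy (ldpChannels d ε)) : ∀ t, IsProbabilityMeasure (transcript O π S t)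
  | 0 => by
    unfold transcript
    exact Measure.isProbabilityMeasure_map (by fun_prop)
  | t + 1 => by
    have := isMarkovKernel_messageKernel O π S t
    have := isProbabilityMeasure_transcript O π S t
    unfold transcript
    exact Measure.isProbabilityMeasure_map (measurable_snoc _ t).aemeasurable

theorem integral_transcript_succ (O : Oracle X) [IsMarkovKernel O] (π : Algorithm X)
    (S : Strategy (ldpChannels d ε)) (t : ℕ) {φ : π.Seed × (Fin (t + 1) → Vec d) → ℝ} {M : ℝ}
    (hφ : Measurable φ) (hM : ∀ z, |φ z| ≤ M) :
    ∫ z, φ z ∂transcript O π S (t + 1) =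
      ∫ z, ∫ y, φ (z.1, Fin.snoc z.2 y) ∂messageKernel O π S t z ∂transcript O π S t := by
  have := isMarkovKernel_messageKernel O π S t
  have := isProbabilityMeasure_transcript O π S t
  rw [transcript, integral_map (measurable_snoc _ t).aemeasurable hφ.aestronglyMeasurable,
    Measure.integral_compProd]
  exact integrable_of_measurable_of_abs_le (hφ.comp (measurable_snoc _ t)) fun z => hM _

/-- As the oracle ignores the query, the past acts on the next message only through the choice of
channel. -/
theorem integral_messageKernel_const (μ : Measure (Vec d)) [IsProbabilityMeasure μ]
    (π : Algorithm X) (S : Strategy (ldpChannels d ε)) (t : ℕ) (z : π.Seed × (Fin t → Vec d))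
    {φ : Vec d → ℝ} {M : ℝ} (hφ : Measurable φ) (hM : ∀ y, |φ y| ≤ M) :
    ∫ y, φ y ∂messageKernel (Kernel.const X μ) π S t z =
      ∫ g, ∫ y, φ y ∂S.kernel t (z.2, g) ∂μ := by
  have := isMarkovKernel_messageKernel (Kernel.const X μ) π S t
  have := isMarkovKernel_strategy S t
  have hint : Integrable φ (messageKernel (Kernel.const X μ) π S t z) :=
    integrable_of_measurable_of_abs_le hφ hM
  unfold messageKernel gradientKernel at hint ⊢
  rw [Kernel.integral_comp hint, Kernel.prod_apply, Kernel.id_apply, Measure.dirac_prod,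
    integral_map (by fun_prop)]
  · simp
  · exact (measurable_integral_kernel hφ).aestronglyMeasurable

/-- The second moment comparison for the transcripts of two query-independent oracles. -/
theorem sq_integral_transcript_le (hε : 0 ≤ ε) {μ ν : Measure (Vec d)} [IsProbabilityMeasure μ]
    [IsProbabilityMeasure ν] {η : ℝ} {a b : Vec d}
    (h : ∀ u : Vec d → ℝ, ∫ x, u x ∂μ - ∫ x, u x ∂ν = η * (u a - u b))
    (π : Algorithm X) (S : Strategy (ldpChannels d ε)) (t : ℕ)
    {φ : π.Seed × (Fin t → Vec d) → ℝ} {M : ℝ} (hφ : Measurable φ) (hM : ∀ z, |φ z| ≤ M) :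
    (∫ z, φ z ∂transcript (Kernel.const X μ) π S t) ^ 2 ≤
      (1 + η ^ 2 * (Real.exp ε - 1) ^ 2) ^ t *
        ∫ z, φ z ^ 2 ∂transcript (Kernel.const X ν) π S t := by
  have hsq : ∀ {β : Type} {f : β → ℝ}, (∀ z, |f z| ≤ M) → ∀ z, |f z ^ 2| ≤ M ^ 2 := fun hf z => by
    rw [abs_pow]; exact pow_le_pow_left₀ (abs_nonneg _) (hf z) 2
  induction t with
  | zero =>
    have := isProbabilityMeasure_transcript (Kernel.const X μ) π S 0
    have hvar := (sq_nonneg _).trans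
      (sq_integral_abs_sub_integral_le (μ := transcript (Kernel.const X μ) π S 0) hφ hM)
    have heq : transcript (Kernel.const X μ) π S 0 = transcript (Kernel.const X ν) π S 0 := rfl
    rw [pow_zero, one_mul, ← heq]
    linarith
  | succ t ih =>
    have := isMarkovKernel_messageKernel (Kernel.const X μ) π S t
    have := isMarkovKernel_messageKernel (Kernel.const X ν) π S t
    have := isProbabilityMeasure_transcript (Kernel.const X ν) π S t
    have := isMarkovKernel_strategy S t
    have hsnoc := measurable_snoc (d := d) π.Seed t
    rw [integral_transcript_succ _ π S t hφ hM,
      integral_transcript_succ _ π S t (hφ.pow_const 2) (hsq hM)]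
    have hmeas : ∀ {f : π.Seed × (Fin (t + 1) → Vec d) → ℝ}, Measurable f →
        ∀ κ : Kernel (π.Seed × (Fin t → Vec d)) (Vec d), IsMarkovKernel κ →
        Measurable fun z => ∫ y, f (z.1, Fin.snoc z.2 y) ∂κ z := fun {f} hf κ _ =>
      (StronglyMeasurable.integral_kernel_prod_right'
        (hf.comp hsnoc).stronglyMeasurable).measurable
    -- The induction hypothesis is applied to the conditional mean of `φ` given the past under `μ`;
    -- its square is then compared, history by history, with the conditional second moment under
    -- `ν`.
    refine (ih (hmeas hφ _ ‹_›) fun z => abs_integral_le_of_abs_le fun y => hM _).trans ?_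
    rw [pow_succ (1 + η ^ 2 * (Real.exp ε - 1) ^ 2) t, mul_assoc (_ ^ t)]
    refine mul_le_mul_of_nonneg_left ?_ (by positivity)
    rw [← integral_const_mul]
    refine integral_mono ?_ ?_ fun z => ?_
    · exact integrable_of_measurable_of_abs_le ((hmeas hφ _ ‹_›).pow_const 2)
        (hsq fun z => abs_integral_le_of_abs_le fun y => hM _)
    · exact (integrable_of_measurable_of_abs_le (hmeas (hφ.pow_const 2) _ ‹_›)
        (fun z => abs_integral_le_of_abs_le fun y => hsq hM _)).const_mul _
    · have hφz : Measurable fun y => φ (z.1, Fin.snoc z.2 y) :=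
        (hφ.comp hsnoc).comp measurable_prodMk_left
      obtain ⟨hmk, hldp⟩ := S.mem t z.2
      dsimp only
      rw [integral_messageKernel_const μ π S t z hφz fun y => hM _,
        integral_messageKernel_const ν π S t z (hφz.pow_const 2) fun y => hsq hM _]
      exact sq_integral_le_of_private hldp hε h hφz fun y => hM _

/-- Le Cam's two-point bound. With `m = E_μ φ`, `E_ν φ ≥ E_ν φ² ≥ m² / 2`, and `1 - m + m² / 2 = 1 /
2 + (m - 1)² / 2`. -/
theorem integral_one_sub_add_integral_ge (hε : 0 ≤ ε) {μ ν : Measure (Vec d)}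
    [IsProbabilityMeasure μ] [IsProbabilityMeasure ν] {η : ℝ} {a b : Vec d}
    (h : ∀ u : Vec d → ℝ, ∫ x, u x ∂μ - ∫ x, u x ∂ν = η * (u a - u b))
    (π : Algorithm X) (S : Strategy (ldpChannels d ε)) (t : ℕ)
    (hC : (1 + η ^ 2 * (Real.exp ε - 1) ^ 2) ^ t ≤ 2)
    {φ : π.Seed × (Fin t → Vec d) → ℝ} (hφ : Measurable φ) (h0 : ∀ z, 0 ≤ φ z)
    (h1 : ∀ z, φ z ≤ 1) :
    1 / 2 ≤ ∫ z, (1 - φ z) ∂transcript (Kernel.const X μ) π S t +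
      ∫ z, φ z ∂transcript (Kernel.const X ν) π S t := by
  have := isProbabilityMeasure_transcript (Kernel.const X μ) π S t
  have := isProbabilityMeasure_transcript (Kernel.const X ν) π S t
  have hM : ∀ z, |φ z| ≤ 1 := fun z => by rw [abs_of_nonneg (h0 z)]; exact h1 z
  have key := sq_integral_transcript_le hε h π S t hφ hM
  have hle : ∫ z, φ z ^ 2 ∂transcript (Kernel.const X ν) π S t ≤
      ∫ z, φ z ∂transcript (Kernel.const X ν) π S t := by
    refine integral_mono (integrable_of_measurable_of_abs_le (M := 1) (hφ.pow_const 2) fun z => ?_)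
      (integrable_of_measurable_of_abs_le hφ hM) fun z => ?_
    · rw [abs_of_nonneg (sq_nonneg _)]; exact pow_le_one₀ (h0 z) (h1 z)
    · dsimp only; nlinarith [h0 z, h1 z]
  have hq : 0 ≤ ∫ z, φ z ^ 2 ∂transcript (Kernel.const X ν) π S t :=
    integral_nonneg fun z => sq_nonneg _
  rw [integral_sub (integrable_const _) (integrable_of_measurable_of_abs_le hφ hM)]
  simp only [integral_const, probReal_univ, smul_eq_mul, mul_one]
  nlinarith [mul_le_mul_of_nonneg_right hC hq,
    sq_nonneg (∫ z, φ z ∂transcript (Kernel.const X μ) π S t - 1)]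

end Transcript

/-! ### Biased linear instances on the cube and Assouad's method -/

section HardInstance

/-- The sign `±1` coded by a Boolean. -/
def boolSign (s : Bool) : ℝ := if s then 1 else -1

theorem boolSign_not (s : Bool) : boolSign (!s) = -boolSign s := by cases s <;> simp [boolSign]

theorem boolSign_mul_self (s : Bool) : boolSign s * boolSign s = 1 := by cases s <;> simp [boolSign]

theorem abs_boolSign (s : Bool) : |boolSign s| = 1 := by cases s <;> simp [boolSign]

variable {d : ℕ}

/-- The vector `± B e_i`. -/
def signedBasis (B : ℝ) (j : Fin d × Bool) : Vec d := Pi.single j.1 (B * boolSign j.2)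

/-- The probability of `± B e_i` under the hard oracle with bias `γ` towards the signs `v`. -/
def hardWeight (γ : ℝ) (v : Fin d → Bool) (j : Fin d × Bool) : ℝ :=
  (1 + γ * (boolSign (v j.1) * boolSign j.2)) / (2 * d)

/-- The law on the vectors `± B e_i` with bias `γ` towards the signs `v`. -/
def hardLaw (B γ : ℝ) (v : Fin d → Bool) : Measure (Vec d) :=
  ∑ j : Fin d × Bool, ENNReal.ofReal (hardWeight γ v j) • Measure.dirac (signedBasis B j)

/-- The linear function with gradient `(B γ / d) v`. -/
def hardFun (B γ : ℝ) (v : Fin d → Bool) (x : Vec d) : ℝ :=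
  B * γ / d * ∑ i, boolSign (v i) * x i

theorem hardWeight_nonneg {γ : ℝ} (h0 : 0 ≤ γ) (h1 : γ ≤ 1) (v : Fin d → Bool) (j : Fin d × Bool) :
    0 ≤ hardWeight γ v j := by
  unfold hardWeight
  refine div_nonneg ?_ (by positivity)
  cases v j.1 <;> cases j.2 <;> simp [boolSign] <;> linarith

theorem sum_hardWeight (hd : 1 ≤ d) (γ : ℝ) (v : Fin d → Bool) : ∑ j, hardWeight γ v j = 1 := by
  have hd' : (d : ℝ) ≠ 0 := by positivity
  have : ∀ i : Fin d, ∑ s : Bool, hardWeight γ v (i, s) = 1 / d := fun i => by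
    simp only [hardWeight, Fintype.sum_bool, boolSign]
    cases v i <;> simp <;> field_simp <;> ring
  rw [Fintype.sum_prod_type, Finset.sum_congr rfl fun i _ => this i]
  simp [hd']

theorem isProbabilityMeasure_hardLaw (hd : 1 ≤ d) (B : ℝ) {γ : ℝ} (h0 : 0 ≤ γ) (h1 : γ ≤ 1)
    (v : Fin d → Bool) : IsProbabilityMeasure (hardLaw B γ v) := by
  constructor
  simp only [hardLaw, Measure.coe_finsetSum, Finset.sum_apply, Measure.smul_apply, measure_univ,
    smul_eq_mul, mul_one]
  rw [← ENNReal.ofReal_sum_of_nonneg fun j _ => hardWeight_nonneg h0 h1 v j, sum_hardWeight hd,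
    ENNReal.ofReal_one]

/-- No measurability of `u` is needed, since the law is a finite sum of atoms. -/
theorem integral_hardLaw {E : Type*} [NormedAddCommGroup E] [NormedSpace ℝ E] [CompleteSpace E]
    (B : ℝ) {γ : ℝ} (h0 : 0 ≤ γ) (h1 : γ ≤ 1) (v : Fin d → Bool) (u : Vec d → E) :
    ∫ x, u x ∂hardLaw B γ v = ∑ j, hardWeight γ v j • u (signedBasis B j) := by
  unfold hardLaw
  rw [integral_finsetSum_measure fun j _ =>
    (integrable_dirac (by simp)).smul_measure ENNReal.ofReal_ne_top]
  refine Finset.sum_congr rfl fun j _ => ?_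
  rw [integral_smul_measure, integral_dirac,
    ENNReal.toReal_ofReal (hardWeight_nonneg h0 h1 v j)]

/-- Only the atoms `± B e_i` see the sign `v i`; the flip exchanges their weights `(1 ± γ) / (2 d)`.
-/
theorem integral_hardLaw_sub_integral_hardLaw_flip (hd : 1 ≤ d) (B : ℝ) {γ : ℝ} (h0 : 0 ≤ γ)
    (h1 : γ ≤ 1) (v : Fin d → Bool) (i : Fin d) (u : Vec d → ℝ) :
    ∫ x, u x ∂hardLaw B γ v - ∫ x, u x ∂hardLaw B γ (Function.update v i (!v i)) =
      γ / d * (u (signedBasis B (i, v i)) - u (signedBasis B (i, !v i))) := by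
  have hd' : (d : ℝ) ≠ 0 := by positivity
  rw [integral_hardLaw B h0 h1, integral_hardLaw B h0 h1, ← Finset.sum_sub_distrib,
    Fintype.sum_prod_type, Finset.sum_eq_single_of_mem i (Finset.mem_univ i)]
  · simp only [hardWeight, Function.update_self, Fintype.sum_bool, boolSign, smul_eq_mul]
    cases v i <;> simp <;> field_simp <;> ring
  · intro k _ hk
    simp [hardWeight, Function.update_of_ne hk]

theorem integral_id_hardLaw (hd : 1 ≤ d) (B : ℝ) {γ : ℝ} (h0 : 0 ≤ γ) (h1 : γ ≤ 1)
    (v : Fin d → Bool) :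
    ∫ x, x ∂hardLaw B γ v = fun i => B * γ / d * boolSign (v i) := by
  have hd' : (d : ℝ) ≠ 0 := by positivity
  rw [integral_hardLaw B h0 h1, Fintype.sum_prod_type]
  ext i
  simp only [Finset.sum_apply, Pi.smul_apply, signedBasis]
  rw [Finset.sum_eq_single_of_mem i (Finset.mem_univ i)]
  · simp only [Pi.single_eq_same, hardWeight, Fintype.sum_bool, boolSign, smul_eq_mul]
    cases v i <;> simp <;> field_simp <;> ring
  · intro k _ hk
    simp [Pi.single_eq_of_ne hk.symm]

theorem pNorm_signedBasis {q : ℝ≥0∞} (hq : 1 ≤ q) (B : ℝ) (j : Fin d × Bool) :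
    pNorm q (signedBasis B j) ^ 2 = B ^ 2 := by
  have : Fact (1 ≤ q) := ⟨hq⟩
  have : pNorm q (signedBasis B j) = ‖B * boolSign j.2‖ :=
    PiLp.norm_single q (fun _ : Fin d => ℝ) j.1 (B * boolSign j.2)
  rw [this, Real.norm_eq_abs, sq_abs, mul_pow, sq (boolSign _), boolSign_mul_self, mul_one]

theorem hard_mem_convexClass {X : Set (Vec d)} (hX : Convex ℝ X) {p : ℝ≥0∞} (hd : 1 ≤ d)
    (B : ℝ) {γ : ℝ} (h0 : 0 ≤ γ) (h1 : γ ≤ 1) (v : Fin d → Bool) :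
    (hardFun B γ v, Kernel.const X (hardLaw B γ v)) ∈ convexClass X p B := by
  have := isProbabilityMeasure_hardLaw hd B h0 h1 v
  refine ⟨⟨hX, fun x _ y _ a b _ _ _ => le_of_eq ?_⟩, inferInstance, fun x => ?_, fun x => ?_⟩
  · simp only [hardFun, Pi.add_apply, Pi.smul_apply, smul_eq_mul, mul_add, Finset.sum_add_distrib,
      Finset.mul_sum]
    congr 1 <;> exact Finset.sum_congr rfl fun i _ => by ring
  · simp only [Kernel.const_apply, integral_id_hardLaw hd B h0 h1]
    intro y _
    refine le_of_eq ?_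
    simp only [hardFun, dotProduct, Pi.sub_apply, Finset.mul_sum]
    rw [← Finset.sum_sub_distrib]
    exact Finset.sum_congr rfl fun i _ => by ring
  · simp only [Kernel.const_apply, hardLaw]
    rw [← Measure.sum_fintype, Measure.ae_sum_iff]
    intro j
    refine Measure.ae_smul_measure ?_ _
    rw [ae_dirac_eq]
    -- The conjugate exponent is defined as `1 + (p - 1)⁻¹`, hence is at least `1`.
    exact (pNorm_signedBasis (by simp [ENNReal.conjExponent]) B j).le

/-- The cube `[-b, b]^d`. -/
def cube (d : ℕ) (b : ℝ) : Set (Vec d) := Set.Icc (fun _ => -b) (fun _ => b)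

theorem mem_cube {b : ℝ} {x : Vec d} : x ∈ cube d b ↔ ∀ i, |x i| ≤ b := by
  simp only [cube, Set.mem_Icc, Pi.le_def, abs_le, forall_and]

theorem pNorm_le_of_abs_le {p : ℝ≥0∞} (hp : 1 ≤ p) (hd : 1 ≤ d) {x : Vec d} {c : ℝ}
    (h : ∀ i, |x i| ≤ c) : pNorm p x ≤ (d : ℝ) ^ (p⁻¹).toReal * c := by
  have : Nonempty (Fin d) := ⟨⟨0, hd⟩⟩
  have hc : 0 ≤ c := (abs_nonneg _).trans (h ⟨0, hd⟩)
  rcases eq_or_ne p ∞ with rfl | hp'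
  · simp only [pNorm, PiLp.norm_eq_ciSup, ENNReal.inv_top, ENNReal.toReal_zero, Real.rpow_zero,
      one_mul]
    exact ciSup_le h
  · have hpos : 0 < p.toReal := ENNReal.toReal_pos (by positivity) hp'
    rw [pNorm, PiLp.norm_eq_sum hpos, ENNReal.toReal_inv, ← one_div]
    calc (∑ i, ‖x i‖ ^ p.toReal) ^ (1 / p.toReal)
        ≤ (d * c ^ p.toReal) ^ (1 / p.toReal) := by
          refine Real.rpow_le_rpow (by positivity) ?_ (by positivity)
          calc ∑ i, ‖x i‖ ^ p.toReal ≤ ∑ _i : Fin d, c ^ p.toReal :=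
                Finset.sum_le_sum fun i _ =>
                  Real.rpow_le_rpow (norm_nonneg _) (h i) hpos.le
            _ = d * c ^ p.toReal := by simp
      _ = (d : ℝ) ^ (1 / p.toReal) * c := by
          rw [Real.mul_rpow (by positivity) (by positivity), one_div,
            Real.rpow_rpow_inv hc hpos.ne']

theorem cube_mem_domains {p : ℝ≥0∞} (hp : 1 ≤ p) (hd : 1 ≤ d) {b D : ℝ} (hb : 0 ≤ b)
    (hD : (d : ℝ) ^ (p⁻¹).toReal * (2 * b) ≤ D) : cube d b ∈ domains d p D := by
  refine ⟨⟨0, mem_cube.2 fun i => by simpa using hb⟩, isCompact_Icc, convex_Icc _ _,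
    fun x hx y hy => (pNorm_le_of_abs_le hp hd fun i => ?_).trans hD⟩
  rw [mem_cube] at hx hy
  exact (abs_sub _ _).trans (by linarith [hx i, hy i])

/-- The loss `(1 + v_i x_i / b) / 2` of the coordinate `i`, with values in `[0, 1]`. -/
def coordLoss (b : ℝ) (s : Bool) (r : ℝ) : ℝ := (1 + boolSign s * r / b) / 2

theorem coordLoss_not (b : ℝ) (s : Bool) (r : ℝ) : coordLoss b (!s) r = 1 - coordLoss b s r := by
  rw [coordLoss, coordLoss, boolSign_not]; ring

theorem coordLoss_mem {b : ℝ} (hb : 0 < b) (s : Bool) {r : ℝ} (hr : |r| ≤ b) :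
    0 ≤ coordLoss b s r ∧ coordLoss b s r ≤ 1 := by
  have : |boolSign s * r / b| ≤ 1 := by
    rw [abs_div, abs_mul, abs_boolSign, one_mul, abs_of_pos hb]
    exact div_le_one_of_le₀ hr hb.le
  rw [abs_le] at this
  unfold coordLoss
  constructor <;> linarith

/-- The infimum is at most the value at the vertex `-b v`, and the gap to that value splits over
coordinates. -/
theorem hardFun_sub_sInf_ge {b : ℝ} (B γ : ℝ) (hb : 0 < b) (v : Fin d → Bool) (x : Vec d) :
    2 * B * γ * b / d * ∑ i, coordLoss b (v i) (x i) ≤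
      hardFun B γ v x - sInf (hardFun B γ v '' cube d b) := by
  have hcont : Continuous (hardFun B γ v) := by unfold hardFun; fun_prop
  have hbdd : BddBelow (hardFun B γ v '' cube d b) := (isCompact_Icc.image hcont).bddBelow
  have hle : sInf (hardFun B γ v '' cube d b) ≤ hardFun B γ v (fun i => -(b * boolSign (v i))) :=
    csInf_le hbdd ⟨_, mem_cube.2 fun i => by
      rw [abs_neg, abs_mul, abs_boolSign, mul_one, abs_of_pos hb], rfl⟩
  refine le_trans (le_of_eq ?_) (sub_le_sub_left hle _)
  simp only [hardFun, coordLoss, Finset.mul_sum]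
  rw [← Finset.sum_sub_distrib]
  refine Finset.sum_congr rfl fun i _ => ?_
  have := boolSign_mul_self (v i)
  field_simp
  linear_combination (-(B * γ * b / d)) * this

/-- Flipping sign `i` is an involution of the sign vectors, so averaging `hF` over `v` gives `F · i`
a mean of at least `1 / 4`; some `v` does at least as well as the average of the sum. -/
theorem exists_sum_ge_of_flip {F : (Fin d → Bool) → Fin d → ℝ}
    (hF : ∀ v i, 1 / 2 ≤ F v i + F (Function.update v i (!v i)) i) :
    ∃ v, (d : ℝ) / 4 ≤ ∑ i, F v i := by
  have hflip : ∀ i, ∑ v, F (Function.update v i (!v i)) i = ∑ v, F v i := fun i => by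
    have hinv : Function.Involutive fun v : Fin d → Bool => Function.update v i (!v i) :=
      fun v => by simp
    exact Equiv.sum_comp hinv.toPerm fun v => F v i
  have hi : ∀ i, ∑ _v : Fin d → Bool, (1 / 4 : ℝ) ≤ ∑ v, F v i := fun i => by
    have := Finset.sum_le_sum fun v (_ : v ∈ Finset.univ) => hF v i
    rw [Finset.sum_add_distrib, hflip i] at this
    simp only [Finset.sum_const, nsmul_eq_mul] at this ⊢
    linarith
  have hsum : ∑ _v : Fin d → Bool, (d : ℝ) / 4 ≤ ∑ v, ∑ i, F v i := by
    rw [Finset.sum_comm]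
    refine le_trans (le_of_eq ?_) (Finset.sum_le_sum fun i _ => hi i)
    simp only [Finset.sum_const, nsmul_eq_mul, Finset.card_univ, Fintype.card_fin]
    ring
  obtain ⟨v, -, hv⟩ := Finset.exists_le_of_sum_le Finset.univ_nonempty hsum
  exact ⟨v, hv⟩

/-- The minmax error on the cube, for the hard instances with bias `γ`. -/
theorem minmaxError_cube_ge {p : ℝ≥0∞} (hd : 1 ≤ d) {ε b B γ : ℝ} (hε : 0 ≤ ε) (hb : 0 < b)
    (hB : 0 ≤ B) (h0 : 0 ≤ γ) (h1 : γ ≤ 1) (T : ℕ)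
    (hC : (1 + (γ / d) ^ 2 * (Real.exp ε - 1) ^ 2) ^ T ≤ 2) :
    ENNReal.ofReal (B * γ * b / 2) ≤
      minmaxError (cube d b) (convexClass (cube d b) p B) T (ldpChannels d ε) := by
  refine le_iInf fun π => le_iInf fun S => ?_
  have hprob := isProbabilityMeasure_hardLaw hd B h0 h1
  let P : (Fin d → Bool) → Measure (π.Seed × (Fin T → Vec d)) := fun v =>
    transcript (Kernel.const (cube d b) (hardLaw B γ v)) π S T
  have hP : ∀ v, IsProbabilityMeasure (P v) := fun v => isProbabilityMeasure_transcript _ π S T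
  let L : Bool → Fin d → π.Seed × (Fin T → Vec d) → ℝ := fun s i z =>
    coordLoss b s ((π.point T z : Vec d) i)
  have hLm : ∀ s i, Measurable (L s i) := fun s i => by
    have : Measurable fun z => (π.point T z : Vec d) i :=
      (measurable_pi_apply i).comp (measurable_subtype_coe.comp (π.measurable_point T))
    change Measurable fun z => (1 + boolSign s * (π.point T z : Vec d) i / b) / 2
    fun_prop
  have hL : ∀ s i z, 0 ≤ L s i z ∧ L s i z ≤ 1 := fun s i z =>
    coordLoss_mem hb s (mem_cube.1 (π.point T z).2 i)
  have hLM : ∀ s i z, |L s i z| ≤ 1 := fun s i z => by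
    rw [abs_of_nonneg (hL s i z).1]; exact (hL s i z).2
  obtain ⟨v, hv⟩ := exists_sum_ge_of_flip (F := fun v i => ∫ z, L (v i) i z ∂P v) fun v i => by
    have := integral_one_sub_add_integral_ge hε
      (integral_hardLaw_sub_integral_hardLaw_flip hd B h0 h1 v i) π S T hC (hLm (!v i) i)
      (fun z => (hL _ i z).1) (fun z => (hL _ i z).2)
    -- Losses for opposite signs are complementary, so a single test `φ = L (!v i) i` yields both
    -- neighbours' losses.
    have hnot : ∀ z, 1 - L (!v i) i z = L (v i) i z := fun z => by
      simp only [L, coordLoss_not]; ring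
    simp only [hnot] at this
    simpa [P] using this
  refine le_trans ?_ (le_iSup₂ (f := fun fO (_ : fO ∈ convexClass (cube d b) p B) =>
    expectedGap T fO.1 fO.2 π S) _ (hard_mem_convexClass (convex_Icc _ _) hd B h0 h1 v))
  have hint : ∀ i ∈ Finset.univ, Integrable (L (v i) i) (P v) := fun i _ =>
    integrable_of_measurable_of_abs_le (hLm _ i) (hLM _ i)
  have hc : 0 ≤ 2 * B * γ * b / d := by positivity
  calc ENNReal.ofReal (B * γ * b / 2)
      ≤ ENNReal.ofReal (2 * B * γ * b / d * ∑ i, ∫ z, L (v i) i z ∂P v) := by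
        refine ENNReal.ofReal_le_ofReal (le_trans (le_of_eq ?_) (mul_le_mul_of_nonneg_left hv hc))
        have hd' : (d : ℝ) ≠ 0 := by positivity
        field_simp
        norm_num
    _ = ENNReal.ofReal (∫ z, 2 * B * γ * b / d * ∑ i, L (v i) i z ∂P v) := by
        rw [integral_const_mul, integral_finsetSum _ hint]
    _ = ∫⁻ z, ENNReal.ofReal (2 * B * γ * b / d * ∑ i, L (v i) i z) ∂P v :=
        ofReal_integral_eq_lintegral_ofReal ((integrable_finsetSum _ hint).const_mul _)
          (.of_forall fun z => mul_nonneg hc (Finset.sum_nonneg fun i _ => (hL _ i z).1))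
    _ ≤ expectedGap T (hardFun B γ v) (Kernel.const (cube d b) (hardLaw B γ v)) π S :=
        lintegral_mono fun z => ENNReal.ofReal_le_ofReal
          (hardFun_sub_sInf_ge B γ hb v (π.point T z))

end HardInstance

/-! ### Numerical bounds and choice of parameters -/

theorem exp_sub_one_le_mul {ε : ℝ} (h0 : 0 ≤ ε) (h1 : ε ≤ 1) :
    Real.exp ε - 1 ≤ (Real.exp 1 - 1) * ε := by
  have := convexOn_exp.2 (Set.mem_univ 0) (Set.mem_univ 1) (sub_nonneg.2 h1) h0 (by ring)
  simp only [smul_eq_mul, mul_zero, mul_one, zero_add, Real.exp_zero] at this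
  linarith

/-- It suffices that `1 / (2 e) ≤ log 2`, by `1 + x ≤ e^x`. -/
theorem one_add_pow_le_two {x : ℝ} {T : ℕ} (hx : 0 ≤ x) (hT : T * x ≤ 1 / (2 * Real.exp 1)) :
    (1 + x) ^ T ≤ 2 := by
  have he := Real.exp_one_gt_d9
  have h2 : T * x ≤ Real.log 2 := hT.trans <| by
    have hlog := Real.log_two_gt_d9
    rw [div_le_iff₀ (by positivity)]
    nlinarith
  calc (1 + x) ^ T ≤ Real.exp x ^ T :=
        pow_le_pow_left₀ (by linarith) (by linarith [Real.add_one_le_exp x]) T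
    _ = Real.exp (T * x) := (Real.exp_nat_mul x T).symm
    _ ≤ 2 := (Real.exp_le_exp.2 h2).trans_eq (Real.exp_log two_pos)

end LDPOpt
end

theorem theoremt :
    ∃ c₀ c₁ : ℝ,
      (c₀ = 1 / (2 * Real.exp 1 * (Real.exp 1 - 1) ^ 2) ∧
        c₁ = 1 / (36 * (Real.exp 1 - 1) * Real.sqrt (2 * Real.exp 1))) ∧
      0 < c₀ ∧ 0 < c₁ ∧
      ∀ (d : ℕ) (p : ENNReal) (ε D B : ℝ) (T : ℕ),
        1 ≤ d → 2 ≤ p → 0 < ε → ε ≤ 1 → 0 < D → 0 < B →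
        c₀ * ((d : ℝ) ^ 2 / ε ^ 2) ≤ (T : ℝ) →
        ENNReal.ofReal
            (c₁ * D * B * (d : ℝ) ^ ((1 / 2 : ℝ) - (p⁻¹).toReal) / Real.sqrt (T : ℝ) *
              Real.sqrt ((d : ℝ) / ε ^ 2)) ≤
          ⨆ X ∈ LDPOpt.domains d p D,
            LDPOpt.minmaxError X (LDPOpt.convexClass X p B) T (LDPOpt.ldpChannels d ε) := by
  have he : 0 < Real.exp 1 - 1 := by linarith [Real.exp_one_gt_d9]
  refine ⟨_, _, ⟨rfl, rfl⟩, by positivity, by positivity, ?_⟩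
  intro d p ε D B T hd hp hε hε1 hD hB hT
  have hd0 : (0 : ℝ) < d := by exact_mod_cast hd
  set k := Real.exp 1 - 1 with hk
  set r := Real.sqrt (2 * Real.exp 1) with hr
  have hr0 : 0 < r := Real.sqrt_pos.2 (by positivity)
  have hr2 : r ^ 2 = 2 * Real.exp 1 := Real.sq_sqrt (by positivity)
  rw [← hr2] at hT
  have hT0 : (0 : ℝ) < T := lt_of_lt_of_le (by positivity) hT
  set w := Real.sqrt (T : ℝ) with hw
  have hw0 : 0 < w := Real.sqrt_pos.2 hT0
  have hw2 : w ^ 2 = T := Real.sq_sqrt hT0.le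
  set a := (p⁻¹).toReal
  set q := (d : ℝ) ^ a with hq
  have hq0 : 0 < q := Real.rpow_pos_of_pos hd0 _
  -- This `γ` makes `T (γ / d)² (k ε)²` equal to `1 / (2 e)`; the lower bound on `T` is exactly `γ ≤
  -- 1`.
  set γ := d / (k * r * ε * w) with hγ
  have hγ0 : 0 ≤ γ := by positivity
  have hγ1 : γ ≤ 1 := by
    refine (sq_le_one_iff₀ hγ0).1 ?_
    calc γ ^ 2 = 1 / (r ^ 2 * k ^ 2) * ((d : ℝ) ^ 2 / ε ^ 2) / T := by
          rw [hγ, ← hw2]; field_simp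
      _ ≤ 1 := (div_le_one hT0).2 hT
  have hC : (1 + (γ / d) ^ 2 * (Real.exp ε - 1) ^ 2) ^ T ≤ 2 := by
    refine LDPOpt.one_add_pow_le_two (by positivity) ?_
    have hexp : (Real.exp ε - 1) ^ 2 ≤ (k * ε) ^ 2 :=
      pow_le_pow_left₀ (by linarith [Real.add_one_le_exp ε])
        (LDPOpt.exp_sub_one_le_mul hε.le hε1) 2
    calc (T : ℝ) * ((γ / d) ^ 2 * (Real.exp ε - 1) ^ 2)
        ≤ T * ((γ / d) ^ 2 * (k * ε) ^ 2) := by gcongr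
      _ = 1 / (2 * Real.exp 1) := by
          rw [hγ, ← hw2, ← hr2]; field_simp
  -- The half-width for which the main diagonal of the cube has `ℓ_p` length `D`.
  have hmem : LDPOpt.cube d (D / (2 * q)) ∈ LDPOpt.domains d p D :=
    LDPOpt.cube_mem_domains (le_trans (by norm_num) hp) hd (by positivity)
      (le_of_eq (by rw [← hq]; field_simp))
  refine le_trans (ENNReal.ofReal_le_ofReal ?_)
    ((LDPOpt.minmaxError_cube_ge hd hε.le (by positivity) hB.le hγ0 hγ1 T hC).trans
      (le_iSup₂ (f := fun X (_ : X ∈ LDPOpt.domains d p D) =>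
        LDPOpt.minmaxError X (LDPOpt.convexClass X p B) T (LDPOpt.ldpChannels d ε)) _ hmem))
  have hsd : Real.sqrt d * Real.sqrt d = d := Real.mul_self_sqrt hd0.le
  rw [Real.rpow_sub hd0, ← Real.sqrt_eq_rpow, ← hq, Real.sqrt_div hd0.le, Real.sqrt_sq hε.le]
  calc 1 / (36 * k * r) * D * B * (Real.sqrt d / q) / w * (Real.sqrt d / ε)
      = D * B * (Real.sqrt d * Real.sqrt d) / (k * r * q * w * ε) * (1 / 36) := by field_simp
    -- The argument yields the constant `1 / 4` where `c₁` asks for `1 / 36`.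
    _ ≤ D * B * (Real.sqrt d * Real.sqrt d) / (k * r * q * w * ε) * (1 / 4) := by
        gcongr; norm_num
    _ = B * γ * (D / (2 * q)) / 2 := by
        rw [hsd, hγ]; field_simp; norm_num
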